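/- Throughout, rings are associative but not necessarily unital. A nonzero ring $R$ is prime if, for $a,b\in R$, $aRb=0$ implies $a=0$ or $b=0$. Let $Z(R)$ be the center of $R$, let $Q_s(R)$ be the Martindale symmetric ring of quotients of a prime ring $R$, and let the extended centroid $C$ be the center of $Q_s(R)$. A Lie ideal of $R$ is an additive subgroup $L$ of $R$ with $xr-rx\in L$ for all $x\in L$, $r\in R$; it is noncentral if $L\not\subseteq Z(R)$. For additive subgroups $A,B$ of a ring, $AB$ is the additive subgroup generated by all products $ab$ with $a\in A$, $b\in B$, and $A^1=A$, $A^{n+1}=A^nA$; the products $KC$ and $LC$ are formed in $Q_s(R)\supseteq R$. **Theorem.** Let $R$ be a prime ring with extended centroid $C$, let $K$ and $L$ be noncentral Lie ideals of $R$, and let $m,n\ge 1$ be integers. Then $K^mL^n$ contains a nonzero two-sided ideal of $R$ except precisely when $$KC=LC=Ca+C\quad\text{for every } a\in K\setminus Z(R).$$ That is, if this condition fails then $K^mL^n$ contains a nonzero ideal of $R$, and if it holds then $K^mL^n$ contains no nonzero ideal of $R$. -/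

import Mathlib

open scoped Pointwise

/-- A ring `R` (associative, not necessarily unital) is prime if it is nonzero and `a R b = 0`
implies `a = 0` or `b = 0`. -/
class IsPrimeRing (R : Type*) [NonUnitalRing R] : Prop extends Nontrivial R where
  eq_zero_or_eq_zero : ∀ a b : R, (∀ x : R, a * x * b = 0) → a = 0 ∨ b = 0

namespace IsPrimeRing

variable {R : Type*} [NonUnitalRing R] [IsPrimeRing R]

theorem exists_mul_mul_ne {a b : R} (ha : a ≠ 0) (hb : b ≠ 0) : ∃ x, a * x * b ≠ 0 := by
  by_contra! h
  exact (eq_zero_or_eq_zero a b h).elim ha hb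

theorem exists_mem_ne {I : TwoSidedIdeal R} (h : I ≠ ⊥) : ∃ a ∈ I, a ≠ 0 := by
  by_contra! h'
  exact h (TwoSidedIdeal.ext fun x => by
    rw [TwoSidedIdeal.mem_bot]
    exact ⟨h' x, fun hx => hx ▸ I.zero_mem⟩)

theorem ne_bot_of_mem {I : TwoSidedIdeal R} {a : R} (ha : a ∈ I) (h : a ≠ 0) : I ≠ ⊥ := by
  rintro rfl
  exact h ((TwoSidedIdeal.mem_bot R).1 ha)

theorem inf_ne_bot {I J : TwoSidedIdeal R} (hI : I ≠ ⊥) (hJ : J ≠ ⊥) : I ⊓ J ≠ ⊥ := by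
  obtain ⟨a, ha, ha0⟩ := exists_mem_ne hI
  obtain ⟨b, hb, hb0⟩ := exists_mem_ne hJ
  obtain ⟨x, hx⟩ := exists_mul_mul_ne ha0 hb0
  exact ne_bot_of_mem (I := I ⊓ J) ((TwoSidedIdeal.mem_inf R).2
    ⟨I.mul_mem_right _ _ (I.mul_mem_right _ _ ha), J.mul_mem_left _ _ hb⟩) hx

theorem top_ne_bot : (⊤ : TwoSidedIdeal R) ≠ ⊥ := by
  obtain ⟨a, ha⟩ := exists_ne (0 : R)
  exact ne_bot_of_mem (I := ⊤) (TwoSidedIdeal.mem_top R) ha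

end IsPrimeRing

/-! ## The Martindale symmetric ring of quotients

An element of `Q_s(R)` is represented by a triple `(f, g, I)`, where `I` is a nonzero ideal of `R`,
`f : I → R` is a homomorphism of right `R`-modules (to be thought of as `x ↦ q x`),
`g : I → R` is a homomorphism of left `R`-modules (to be thought of as `x ↦ x q`), and
`x (f y) = (g x) y` for all `x, y ∈ I`. Two triples represent the same element if they agree on
some nonzero ideal contained in both domains. -/

/-- A triple `(f, g, I)` as above. The maps are recorded as functions on `R`; their values outside
`I` are irrelevant. -/
structure MartindaleTriple (R : Type*) [NonUnitalRing R] where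
  I : TwoSidedIdeal R
  f : R → R
  g : R → R
  ne_bot : I ≠ ⊥
  f_add : ∀ x ∈ I, ∀ y ∈ I, f (x + y) = f x + f y
  f_mul : ∀ x ∈ I, ∀ r, f (x * r) = f x * r
  g_add : ∀ x ∈ I, ∀ y ∈ I, g (x + y) = g x + g y
  g_mul : ∀ x ∈ I, ∀ r, g (r * x) = r * g x
  balanced : ∀ x ∈ I, ∀ y ∈ I, x * f y = g x * y

namespace MartindaleTriple

variable {R : Type*} [NonUnitalRing R]

theorem f_zero (p : MartindaleTriple R) : p.f 0 = 0 := by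
  simpa using p.f_mul 0 p.I.zero_mem 0

theorem g_zero (p : MartindaleTriple R) : p.g 0 = 0 := by
  simpa using p.g_mul 0 p.I.zero_mem 0

theorem f_neg (p : MartindaleTriple R) {x : R} (hx : x ∈ p.I) : p.f (-x) = -p.f x := by
  have h := p.f_add x hx (-x) (p.I.neg_mem hx)
  rw [add_neg_cancel, f_zero] at h
  exact (neg_eq_of_add_eq_zero_right h.symm).symm

theorem g_neg (p : MartindaleTriple R) {x : R} (hx : x ∈ p.I) : p.g (-x) = -p.g x := by
  have h := p.g_add x hx (-x) (p.I.neg_mem hx)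
  rw [add_neg_cancel, g_zero] at h
  exact (neg_eq_of_add_eq_zero_right h.symm).symm

/-- Two triples agree on a nonzero ideal contained in both domains. -/
def Rel (p q : MartindaleTriple R) : Prop :=
  ∃ J : TwoSidedIdeal R, J ≠ ⊥ ∧ J ≤ p.I ∧ J ≤ q.I ∧ ∀ x ∈ J, p.f x = q.f x ∧ p.g x = q.g x

variable [IsPrimeRing R]

theorem rel_of_agree {p q : MartindaleTriple R} (J : TwoSidedIdeal R) (hJ : J ≠ ⊥)
    (h : ∀ x ∈ J, x ∈ p.I → x ∈ q.I → p.f x = q.f x ∧ p.g x = q.g x) : Rel p q :=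
  ⟨J ⊓ (p.I ⊓ q.I), IsPrimeRing.inf_ne_bot hJ (IsPrimeRing.inf_ne_bot p.ne_bot q.ne_bot),
    inf_le_right.trans inf_le_left, inf_le_right.trans inf_le_right,
    fun x hx => h x hx.1 hx.2.1 hx.2.2⟩

theorem rel_of_forall {p q : MartindaleTriple R}
    (h : ∀ x, x ∈ p.I → x ∈ q.I → p.f x = q.f x ∧ p.g x = q.g x) : Rel p q :=
  rel_of_agree ⊤ IsPrimeRing.top_ne_bot fun x _ => h x

instance setoid (R : Type*) [NonUnitalRing R] [IsPrimeRing R] :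
    Setoid (MartindaleTriple R) where
  r := Rel
  iseqv :=
    { refl := fun _ => rel_of_forall fun _ _ _ => ⟨rfl, rfl⟩
      symm := fun ⟨J, hJ, h1, h2, h⟩ =>
        ⟨J, hJ, h2, h1, fun x hx => ⟨(h x hx).1.symm, (h x hx).2.symm⟩⟩
      trans := fun ⟨J, hJ, _, _, h⟩ ⟨J', hJ', _, _, h'⟩ =>
        rel_of_agree (J ⊓ J') (IsPrimeRing.inf_ne_bot hJ hJ') fun x hx _ _ =>
          ⟨(h x hx.1).1.trans (h' x hx.2).1, (h x hx.1).2.trans (h' x hx.2).2⟩ }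

/-- An ideal inside `J` and the domain of `p` that both maps of `p` send into `J`. -/
def pre (p : MartindaleTriple R) (J : TwoSidedIdeal R) : TwoSidedIdeal R :=
  TwoSidedIdeal.mk'
    {x | (x ∈ J ∧ x ∈ p.I) ∧ (p.f x ∈ J ∧ ∀ r, p.f (r * x) ∈ J) ∧
      (p.g x ∈ J ∧ ∀ r, p.g (x * r) ∈ J)}
    (by simp [f_zero, g_zero])
    (by
      rintro x y ⟨⟨hx, hx'⟩, ⟨h1, h2⟩, h3, h4⟩ ⟨⟨hy, hy'⟩, ⟨k1, k2⟩, k3, k4⟩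
      refine ⟨⟨J.add_mem hx hy, p.I.add_mem hx' hy'⟩, ⟨?_, fun r => ?_⟩, ?_, fun r => ?_⟩
      · rw [p.f_add x hx' y hy']; exact J.add_mem h1 k1
      · rw [mul_add, p.f_add _ (p.I.mul_mem_left _ _ hx') _ (p.I.mul_mem_left _ _ hy')]
        exact J.add_mem (h2 r) (k2 r)
      · rw [p.g_add x hx' y hy']; exact J.add_mem h3 k3
      · rw [add_mul, p.g_add _ (p.I.mul_mem_right _ _ hx') _ (p.I.mul_mem_right _ _ hy')]
        exact J.add_mem (h4 r) (k4 r))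
    (by
      rintro x ⟨⟨hx, hx'⟩, ⟨h1, h2⟩, h3, h4⟩
      refine ⟨⟨J.neg_mem hx, p.I.neg_mem hx'⟩, ⟨?_, fun r => ?_⟩, ?_, fun r => ?_⟩
      · rw [p.f_neg hx']; exact J.neg_mem h1
      · rw [mul_neg, p.f_neg (p.I.mul_mem_left _ _ hx')]; exact J.neg_mem (h2 r)
      · rw [p.g_neg hx']; exact J.neg_mem h3
      · rw [neg_mul, p.g_neg (p.I.mul_mem_right _ _ hx')]; exact J.neg_mem (h4 r))
    (by
      rintro s x ⟨⟨hx, hx'⟩, ⟨h1, h2⟩, h3, h4⟩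
      refine ⟨⟨J.mul_mem_left _ _ hx, p.I.mul_mem_left _ _ hx'⟩, ⟨h2 s, fun r => ?_⟩, ?_,
        fun r => ?_⟩
      · rw [← mul_assoc]; exact h2 _
      · rw [p.g_mul x hx']; exact J.mul_mem_left _ _ h3
      · rw [mul_assoc, p.g_mul _ (p.I.mul_mem_right _ _ hx')]; exact J.mul_mem_left _ _ (h4 r))
    (by
      rintro x s ⟨⟨hx, hx'⟩, ⟨h1, h2⟩, h3, h4⟩
      refine ⟨⟨J.mul_mem_right _ _ hx, p.I.mul_mem_right _ _ hx'⟩, ⟨?_, fun r => ?_⟩, h4 s,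
        fun r => ?_⟩
      · rw [p.f_mul x hx']; exact J.mul_mem_right _ _ h1
      · rw [← mul_assoc, p.f_mul _ (p.I.mul_mem_left _ _ hx')]; exact J.mul_mem_right _ _ (h2 r)
      · rw [mul_assoc]; exact h4 _)

theorem mem_pre {p : MartindaleTriple R} {J : TwoSidedIdeal R} {x : R} :
    x ∈ p.pre J ↔ (x ∈ J ∧ x ∈ p.I) ∧ (p.f x ∈ J ∧ ∀ r, p.f (r * x) ∈ J) ∧
      (p.g x ∈ J ∧ ∀ r, p.g (x * r) ∈ J) :=
  TwoSidedIdeal.mem_mk' _ _ _ _ _ _ _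

theorem pre_ne_bot (p : MartindaleTriple R) {J : TwoSidedIdeal R} (hJ : J ≠ ⊥) :
    p.pre J ≠ ⊥ := by
  obtain ⟨a, ⟨haJ, haI⟩, ha⟩ := IsPrimeRing.exists_mem_ne (IsPrimeRing.inf_ne_bot hJ p.ne_bot)
  obtain ⟨r, hr⟩ := IsPrimeRing.exists_mul_mul_ne ha ha
  replace haJ : a ∈ J := haJ
  replace haI : a ∈ p.I := haI
  refine IsPrimeRing.ne_bot_of_mem (a := a * r * a) (mem_pre.2 ⟨⟨J.mul_mem_left _ _ haJ,
    p.I.mul_mem_left _ _ haI⟩, ⟨?_, fun s => ?_⟩, ?_, fun s => ?_⟩) hr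
  · rw [mul_assoc, p.f_mul a haI]
    exact J.mul_mem_left _ _ (J.mul_mem_left _ _ haJ)
  · rw [mul_assoc, ← mul_assoc s, p.f_mul _ (p.I.mul_mem_left _ _ haI)]
    exact J.mul_mem_left _ _ (J.mul_mem_left _ _ haJ)
  · rw [p.g_mul a haI]
    exact J.mul_mem_right _ _ (J.mul_mem_right _ _ haJ)
  · rw [mul_assoc, p.g_mul _ (p.I.mul_mem_right _ _ haI)]
    exact J.mul_mem_right _ _ (J.mul_mem_right _ _ haJ)

/-- The triple of multiplications by an element of `R`. -/
def ofRing (r : R) : MartindaleTriple R where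
  I := ⊤
  f x := r * x
  g x := x * r
  ne_bot := IsPrimeRing.top_ne_bot
  f_add _ _ _ _ := mul_add _ _ _
  f_mul _ _ _ := (mul_assoc _ _ _).symm
  g_add _ _ _ _ := add_mul _ _ _
  g_mul _ _ _ := mul_assoc _ _ _
  balanced _ _ _ _ := (mul_assoc _ _ _).symm

/-- The triple of identity maps. -/
protected def one : MartindaleTriple R where
  I := ⊤
  f x := x
  g x := x
  ne_bot := IsPrimeRing.top_ne_bot
  f_add _ _ _ _ := rfl
  f_mul _ _ _ := rfl
  g_add _ _ _ _ := rfl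
  g_mul _ _ _ := rfl
  balanced _ _ _ _ := rfl

/-- Pointwise sum on the intersection of the domains. -/
protected def add (p q : MartindaleTriple R) : MartindaleTriple R where
  I := p.I ⊓ q.I
  f x := p.f x + q.f x
  g x := p.g x + q.g x
  ne_bot := IsPrimeRing.inf_ne_bot p.ne_bot q.ne_bot
  f_add x hx y hy := by rw [p.f_add x hx.1 y hy.1, q.f_add x hx.2 y hy.2]; abel
  f_mul x hx r := by rw [p.f_mul x hx.1, q.f_mul x hx.2, add_mul]
  g_add x hx y hy := by rw [p.g_add x hx.1 y hy.1, q.g_add x hx.2 y hy.2]; abel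
  g_mul x hx r := by rw [p.g_mul x hx.1, q.g_mul x hx.2, mul_add]
  balanced x hx y hy := by
    rw [mul_add, add_mul, p.balanced x hx.1 y hy.1, q.balanced x hx.2 y hy.2]

/-- Pointwise negative. -/
protected def neg (p : MartindaleTriple R) : MartindaleTriple R where
  I := p.I
  f x := -p.f x
  g x := -p.g x
  ne_bot := p.ne_bot
  f_add x hx y hy := by rw [p.f_add x hx y hy]; abel
  f_mul x hx r := by rw [p.f_mul x hx, neg_mul]
  g_add x hx y hy := by rw [p.g_add x hx y hy]; abel
  g_mul x hx r := by rw [p.g_mul x hx, mul_neg]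
  balanced x hx y hy := by rw [mul_neg, neg_mul, p.balanced x hx y hy]

/-- Composition: `(pq) x = p (q x)` and `x (pq) = (x p) q`, on an ideal where both make sense. -/
protected def mul (p q : MartindaleTriple R) : MartindaleTriple R where
  I := q.pre p.I ⊓ p.pre q.I
  f x := p.f (q.f x)
  g x := q.g (p.g x)
  ne_bot := IsPrimeRing.inf_ne_bot (q.pre_ne_bot p.ne_bot) (p.pre_ne_bot q.ne_bot)
  f_add x hx y hy := by
    obtain ⟨⟨_, a⟩, ⟨b, _⟩, _⟩ := mem_pre.1 hx.1
    obtain ⟨⟨_, a'⟩, ⟨b', _⟩, _⟩ := mem_pre.1 hy.1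
    rw [q.f_add x a y a', p.f_add _ b _ b']
  f_mul x hx r := by
    obtain ⟨⟨_, a⟩, ⟨b, _⟩, _⟩ := mem_pre.1 hx.1
    rw [q.f_mul x a, p.f_mul _ b]
  g_add x hx y hy := by
    obtain ⟨⟨_, a⟩, _, ⟨b, _⟩⟩ := mem_pre.1 hx.2
    obtain ⟨⟨_, a'⟩, _, ⟨b', _⟩⟩ := mem_pre.1 hy.2
    rw [p.g_add x a y a', q.g_add _ b _ b']
  g_mul x hx r := by
    obtain ⟨⟨_, a⟩, _, ⟨b, _⟩⟩ := mem_pre.1 hx.2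
    rw [p.g_mul x a, q.g_mul _ b]
  balanced x hx y hy := by
    obtain ⟨⟨_, a⟩, _, ⟨b, _⟩⟩ := mem_pre.1 hx.2
    obtain ⟨⟨_, a'⟩, ⟨b', _⟩, _⟩ := mem_pre.1 hy.1
    rw [p.balanced x a _ b', q.balanced _ b y a']

end MartindaleTriple

/-- The Martindale symmetric ring of quotients `Q_s(R)` of a prime ring `R`. -/
def SymmetricQuotientRing (R : Type*) [NonUnitalRing R] [IsPrimeRing R] : Type _ :=
  Quotient (MartindaleTriple.setoid R)

namespace SymmetricQuotientRing

variable {R : Type*} [NonUnitalRing R] [IsPrimeRing R]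

/-- The element of `Q_s(R)` represented by a triple. -/
def mk (p : MartindaleTriple R) : SymmetricQuotientRing R :=
  Quotient.mk (MartindaleTriple.setoid R) p

theorem mk_eq_mk {p q : MartindaleTriple R} : mk p = mk q ↔ p.Rel q :=
  Quotient.eq (r := MartindaleTriple.setoid R)

instance : Zero (SymmetricQuotientRing R) := ⟨mk (MartindaleTriple.ofRing 0)⟩

instance : One (SymmetricQuotientRing R) := ⟨mk MartindaleTriple.one⟩

instance : Add (SymmetricQuotientRing R) :=
  ⟨Quotient.map₂ MartindaleTriple.add (by
    rintro p p' ⟨J, hJ, _, _, h⟩ q q' ⟨J', hJ', _, _, h'⟩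
    refine MartindaleTriple.rel_of_agree (J ⊓ J') (IsPrimeRing.inf_ne_bot hJ hJ')
      fun x hx _ _ => ⟨?_, ?_⟩
    · exact congrArg₂ (· + ·) (h x hx.1).1 (h' x hx.2).1
    · exact congrArg₂ (· + ·) (h x hx.1).2 (h' x hx.2).2)⟩

instance : Neg (SymmetricQuotientRing R) :=
  ⟨Quotient.map MartindaleTriple.neg (by
    rintro p p' ⟨J, hJ, _, _, h⟩
    exact MartindaleTriple.rel_of_agree J hJ fun x hx _ _ =>
      ⟨congrArg (- ·) (h x hx).1, congrArg (- ·) (h x hx).2⟩)⟩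

instance : Mul (SymmetricQuotientRing R) :=
  ⟨Quotient.map₂ MartindaleTriple.mul (by
    rintro p p' ⟨J, hJ, _, _, h⟩ q q' ⟨J', hJ', _, _, h'⟩
    refine MartindaleTriple.rel_of_agree (q.pre J ⊓ p.pre J')
      (IsPrimeRing.inf_ne_bot (q.pre_ne_bot hJ) (p.pre_ne_bot hJ')) fun x hx _ _ => ?_
    obtain ⟨⟨xJ, _⟩, ⟨qx, _⟩, _⟩ := MartindaleTriple.mem_pre.1 hx.1
    obtain ⟨⟨xJ', _⟩, _, ⟨px, _⟩⟩ := MartindaleTriple.mem_pre.1 hx.2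
    constructor
    · change p.f (q.f x) = p'.f (q'.f x)
      rw [(h _ qx).1, (h' x xJ').1]
    · change q.g (p.g x) = q'.g (p'.g x)
      rw [(h' _ px).2, (h x xJ).2])⟩

theorem mk_add (p q : MartindaleTriple R) : mk p + mk q = mk (p.add q) := rfl

theorem mk_neg (p : MartindaleTriple R) : -mk p = mk p.neg := rfl

theorem mk_mul (p q : MartindaleTriple R) : mk p * mk q = mk (p.mul q) := rfl

theorem zero_def : (0 : SymmetricQuotientRing R) = mk (MartindaleTriple.ofRing 0) := rfl

theorem one_def : (1 : SymmetricQuotientRing R) = mk MartindaleTriple.one := rfl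

theorem mk_eq_of_forall {p q : MartindaleTriple R}
    (h : ∀ x, x ∈ p.I → x ∈ q.I → p.f x = q.f x ∧ p.g x = q.g x) : mk p = mk q :=
  mk_eq_mk.2 (MartindaleTriple.rel_of_forall h)

theorem ind {P : SymmetricQuotientRing R → Prop} (h : ∀ p, P (mk p)) (a) : P a :=
  Quotient.ind h a

instance : Ring (SymmetricQuotientRing R) where
  add_assoc := by
    refine ind fun p => ind fun q => ind fun r => mk_eq_of_forall fun x _ _ => ⟨?_, ?_⟩
    · exact add_assoc (p.f x) (q.f x) (r.f x)
    · exact add_assoc (p.g x) (q.g x) (r.g x)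
  zero_add := by
    refine ind fun p => mk_eq_of_forall fun x _ _ => ⟨?_, ?_⟩
    · change 0 * x + p.f x = p.f x
      rw [zero_mul, zero_add]
    · change x * 0 + p.g x = p.g x
      rw [mul_zero, zero_add]
  add_zero := by
    refine ind fun p => mk_eq_of_forall fun x _ _ => ⟨?_, ?_⟩
    · change p.f x + 0 * x = p.f x
      rw [zero_mul, add_zero]
    · change p.g x + x * 0 = p.g x
      rw [mul_zero, add_zero]
  add_comm := by
    refine ind fun p => ind fun q => mk_eq_of_forall fun x _ _ => ⟨?_, ?_⟩
    · exact add_comm (p.f x) (q.f x)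
    · exact add_comm (p.g x) (q.g x)
  neg_add_cancel := by
    refine ind fun p => mk_eq_of_forall fun x _ _ => ⟨?_, ?_⟩
    · change -p.f x + p.f x = 0 * x
      rw [zero_mul, neg_add_cancel]
    · change -p.g x + p.g x = x * 0
      rw [mul_zero, neg_add_cancel]
  mul_assoc := by
    exact ind fun p => ind fun q => ind fun r => mk_eq_of_forall fun x _ _ => ⟨rfl, rfl⟩
  one_mul := ind fun p => mk_eq_of_forall fun x _ _ => ⟨rfl, rfl⟩
  mul_one := ind fun p => mk_eq_of_forall fun x _ _ => ⟨rfl, rfl⟩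
  zero_mul := by
    refine ind fun p => mk_eq_of_forall fun x _ _ => ⟨?_, ?_⟩
    · change 0 * p.f x = 0 * x
      rw [zero_mul, zero_mul]
    · change p.g (x * 0) = x * 0
      rw [mul_zero, p.g_zero]
  mul_zero := by
    refine ind fun p => mk_eq_of_forall fun x _ _ => ⟨?_, ?_⟩
    · change p.f (0 * x) = 0 * x
      rw [zero_mul, p.f_zero]
    · change p.g x * 0 = x * 0
      rw [mul_zero, mul_zero]
  left_distrib := by
    refine ind fun p => ind fun q => ind fun r => mk_eq_of_forall fun x _ hx => ⟨?_, rfl⟩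
    obtain ⟨_, ⟨hq, _⟩, _⟩ := MartindaleTriple.mem_pre.1 hx.1.1
    obtain ⟨_, ⟨hr, _⟩, _⟩ := MartindaleTriple.mem_pre.1 hx.2.1
    exact p.f_add _ hq _ hr
  right_distrib := by
    refine ind fun p => ind fun q => ind fun r => mk_eq_of_forall fun x _ hx => ⟨rfl, ?_⟩
    obtain ⟨_, _, ⟨hp, _⟩⟩ := MartindaleTriple.mem_pre.1 hx.1.2
    obtain ⟨_, _, ⟨hq, _⟩⟩ := MartindaleTriple.mem_pre.1 hx.2.2
    exact r.g_add _ hp _ hq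
  nsmul := nsmulRec
  zsmul := zsmulRec

variable (R) in
/-- The canonical embedding of `R` into `Q_s(R)`. -/
def of : R →ₙ+* SymmetricQuotientRing R where
  toFun r := mk (MartindaleTriple.ofRing r)
  map_mul' a b := mk_eq_of_forall fun x _ _ => ⟨mul_assoc a b x, (mul_assoc x a b).symm⟩
  map_zero' := rfl
  map_add' a b := mk_eq_of_forall fun x _ _ => ⟨add_mul a b x, mul_add x a b⟩

end SymmetricQuotientRing

/-- The extended centroid `C` of a prime ring `R`: the center of `Q_s(R)`. -/
def extendedCentroid (R : Type*) [NonUnitalRing R] [IsPrimeRing R] :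
    Subring (SymmetricQuotientRing R) :=
  Subring.center (SymmetricQuotientRing R)

/-- `AC` for an additive subgroup `A` of `R`: the additive subgroup of `Q_s(R)` generated by all
products `a c` with `a ∈ A` and `c ∈ C`. -/
def mulExtendedCentroid {R : Type*} [NonUnitalRing R] [IsPrimeRing R] (A : AddSubgroup R) :
    AddSubgroup (SymmetricQuotientRing R) :=
  A.map (SymmetricQuotientRing.of R).toAddMonoidHom * (extendedCentroid R).toAddSubgroup

/-- The set `C a + C` for an element `a` of `R`. -/
def centroidLine {R : Type*} [NonUnitalRing R] [IsPrimeRing R] (a : R) :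
    Set (SymmetricQuotientRing R) :=
  {q | ∃ c ∈ extendedCentroid R, ∃ d ∈ extendedCentroid R, q = c * SymmetricQuotientRing.of R a + d}

/-- `L` is a Lie ideal of `R`: an additive subgroup with `[L, R] ⊆ L`. -/
def IsLieIdeal {R : Type*} [NonUnitalRing R] (L : AddSubgroup R) : Prop :=
  ∀ x ∈ L, ∀ r : R, x * r - r * x ∈ L

/-- `L` is central: `L ⊆ Z(R)`. -/
def IsCentral {R : Type*} [NonUnitalRing R] (L : AddSubgroup R) : Prop :=
  ∀ x ∈ L, x ∈ NonUnitalSubring.center R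

/-- The power `L ^ n` for `n ≥ 1`, where the product of two additive subgroups is the additive
subgroup generated by the products of their elements. -/
def addSubgroupPow {R : Type*} [NonUnitalRing R] (L : AddSubgroup R) (n : ℕ+) : AddSubgroup R :=
  PNat.recOn n L fun _ M => M * L

/-- `A` contains a nonzero two-sided ideal of `R`. -/
def ContainsNonzeroIdeal {R : Type*} [NonUnitalRing R] (A : AddSubgroup R) : Prop :=
  ∃ I : TwoSidedIdeal R, I ≠ ⊥ ∧ ∀ x ∈ I, x ∈ A

/-!
If `⁅a, b⁆ ≠ 0` for some `a ∈ K` and `b ∈ L`, then `y⁅a, b⁆⁅b, w⁆ = ⁅a, yb⁆⁅b, w⁆ - ⁅a, y⁆⁅b, bw⁆`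
lies in `KL` for all `y` and `w`. Some `t = ⁅a, b⁆⁅b, w⁆` is nonzero, and since `KL` is a Lie ideal
it contains `RtR`, hence a nonzero ideal; multiplying by further nonzero Lie ideals preserves this.

If `K` and `L` commute, take noncentral `a ∈ K` and `b ∈ L`. Then `⁅a, ⁅b, r⁆⁆ = 0` for all `r`,
which forces `⁅a, r⁆t⁅b, s⁆ = -⁅b, r⁆t⁅a, s⁆`. By Martindale's lemma `⁅b, s⁆ = c⁅a, s⁆` for a single
`c ∈ C`, so that `b - ca ∈ C`. Thus `K` and `L` lie in `Ca + C`, and they span it over `C` because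
`⁅a, R⁆ ⊆ Ca` would force `a² = 0` and then `aRa = 0`.

Conversely, if `K` and `L` lie in `Ca + C`, then `K^m L^n` lies in the commutative ring `C[a]`,
while a prime ring with a nonzero commutative ideal is commutative.
-/

namespace IsPrimeRing

variable {R : Type*} [NonUnitalRing R] [IsPrimeRing R]

theorem eq_zero_of_ideal_mul {I : TwoSidedIdeal R} (hI : I ≠ ⊥) {c : R}
    (h : ∀ x ∈ I, x * c = 0) : c = 0 := by
  obtain ⟨x, hx, hx0⟩ := exists_mem_ne hI
  exact (eq_zero_or_eq_zero x c fun r => h _ (I.mul_mem_right _ _ hx)).resolve_left hx0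

theorem eq_zero_of_mul_ideal {I : TwoSidedIdeal R} (hI : I ≠ ⊥) {c : R}
    (h : ∀ x ∈ I, c * x = 0) : c = 0 := by
  obtain ⟨x, hx, hx0⟩ := exists_mem_ne hI
  refine (eq_zero_or_eq_zero c x fun r => ?_).resolve_right hx0
  rw [mul_assoc, h _ (I.mul_mem_left _ _ hx)]

theorem commute_of_commute_on_ideal {I : TwoSidedIdeal R} (hI : I ≠ ⊥)
    (h : ∀ x ∈ I, ∀ y ∈ I, Commute x y) (r s : R) : Commute r s := by
  have commute_mem : ∀ y ∈ I, ∀ r, Commute r y := fun y hy r =>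
    sub_eq_zero.1 <| eq_zero_of_ideal_mul hI fun x hx => by
      rw [mul_sub, sub_eq_zero]
      calc x * (r * y) = x * r * y := (mul_assoc _ _ _).symm
        _ = y * (x * r) := h _ (I.mul_mem_right x r hx) y hy
        _ = x * (y * r) := by rw [← mul_assoc, ← (h x hx y hy).eq, mul_assoc]
  refine sub_eq_zero.1 <| eq_zero_of_ideal_mul hI fun y hy => ?_
  rw [mul_sub, sub_eq_zero]
  calc y * (r * s) = r * (y * s) := by rw [← mul_assoc, ← (commute_mem y hy r).eq, mul_assoc]
    _ = y * (s * r) := by rw [(commute_mem _ (I.mul_mem_right y s hy) r).eq, mul_assoc]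

end IsPrimeRing

section AddSubgroupMul

variable {R : Type*} [NonUnitalRing R]

theorem mul_mem_addSubgroup_mul {A B : AddSubgroup R} {a b : R} (ha : a ∈ A) (hb : b ∈ B) :
    a * b ∈ A * B :=
  AddSubmonoid.mul_mem_mul (M := A.toAddSubmonoid) (N := B.toAddSubmonoid) ha hb

theorem addSubgroup_mul_le {A B D : AddSubgroup R} : A * B ≤ D ↔ ∀ a ∈ A, ∀ b ∈ B, a * b ∈ D :=
  AddSubmonoid.mul_le (M := A.toAddSubmonoid) (N := B.toAddSubmonoid) (P := D.toAddSubmonoid)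

theorem addSubgroup_mul_assoc (A B D : AddSubgroup R) : A * B * D = A * (B * D) :=
  AddSubgroup.toAddSubmonoid_injective
    (mul_assoc A.toAddSubmonoid B.toAddSubmonoid D.toAddSubmonoid)

theorem addSubgroupPow_one (L : AddSubgroup R) : addSubgroupPow L 1 = L := rfl

theorem addSubgroupPow_succ (L : AddSubgroup R) (n : ℕ+) :
    addSubgroupPow L (n + 1) = addSubgroupPow L n * L :=
  PNat.recOn_succ n (p := fun _ => AddSubgroup R) L _

theorem addSubgroupPow_le {A : AddSubgroup R} {D : NonUnitalSubring R}
    (h : A ≤ D.toAddSubgroup) (n : ℕ+) : addSubgroupPow A n ≤ D.toAddSubgroup := by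
  induction n using PNat.recOn with
  | one => exact h
  | succ n ih =>
    rw [addSubgroupPow_succ]
    exact addSubgroup_mul_le.2 fun x hx y hy => D.mul_mem (ih hx) (h hy)

end AddSubgroupMul

section Commutator

variable {R : Type*} [NonUnitalRing R]

theorem lie_mul_eq_add (a r s : R) : ⁅a, r * s⁆ = ⁅a, r⁆ * s + r * ⁅a, s⁆ := by
  simp only [Ring.lie_def]
  noncomm_ring

theorem mul_lie_eq_add (a b r : R) : ⁅a * b, r⁆ = a * ⁅b, r⁆ + ⁅a, r⁆ * b := by
  simp only [Ring.lie_def]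
  noncomm_ring

theorem exists_lie_ne_zero {a : R} (ha : a ∉ NonUnitalSubring.center R) : ∃ r : R, ⁅a, r⁆ ≠ 0 := by
  by_contra! h
  exact ha (NonUnitalSubring.mem_center_iff.2 fun r => (commute_iff_lie_eq.2 (h r)).symm)

theorem exists_lie_mul_lie_ne_zero [IsPrimeRing R] {a b : R} (hab : ⁅a, b⁆ ≠ 0) :
    ∃ w, ⁅a, b⁆ * ⁅b, w⁆ ≠ 0 := by
  by_contra! h
  obtain ⟨r, hr⟩ := IsPrimeRing.exists_mul_mul_ne hab hab
  refine hr ?_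
  calc ⁅a, b⁆ * r * ⁅a, b⁆ = ⁅a, b⁆ * ⁅b, r⁆ * a - ⁅a, b⁆ * ⁅b, r * a⁆ := by
        simp only [Ring.lie_def]
        noncomm_ring
    _ = 0 := by rw [h, h, zero_mul, sub_zero]

theorem lie_mul_mul_lie_add_eq_zero {a b : R} (h : ∀ r : R, ⁅a, ⁅b, r⁆⁆ = 0) (r t s : R) :
    ⁅a, r⁆ * t * ⁅b, s⁆ + ⁅b, r⁆ * t * ⁅a, s⁆ = 0 := by
  have lie_mul_lie_add_eq_zero (r s : R) : ⁅a, r⁆ * ⁅b, s⁆ + ⁅b, r⁆ * ⁅a, s⁆ = 0 := by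
    have hrs : ⁅a, r⁆ * ⁅b, s⁆ + ⁅b, r⁆ * ⁅a, s⁆ =
        ⁅a, ⁅b, r * s⁆⁆ - ⁅a, ⁅b, r⁆⁆ * s - r * ⁅a, ⁅b, s⁆⁆ := by
      simp only [Ring.lie_def]
      noncomm_ring
    rw [hrs, h, h, h, zero_mul, mul_zero, sub_zero, sub_zero]
  have hrt := lie_mul_lie_add_eq_zero (r * t) s
  have expand : ⁅a, r * t⁆ * ⁅b, s⁆ + ⁅b, r * t⁆ * ⁅a, s⁆ =
      (⁅a, r⁆ * t * ⁅b, s⁆ + ⁅b, r⁆ * t * ⁅a, s⁆) +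
        r * (⁅a, t⁆ * ⁅b, s⁆ + ⁅b, t⁆ * ⁅a, s⁆) := by
    rw [lie_mul_eq_add, lie_mul_eq_add]
    noncomm_ring
  rwa [expand, lie_mul_lie_add_eq_zero t s, mul_zero, add_zero] at hrt

end Commutator

theorem ne_bot_of_not_isCentral {R : Type*} [NonUnitalRing R] {A : AddSubgroup R}
    (h : ¬ IsCentral A) : A ≠ ⊥ := by
  rintro rfl
  exact h fun x hx => AddSubgroup.mem_bot.1 hx ▸ zero_mem _

namespace IsLieIdeal

variable {R : Type*} [NonUnitalRing R] {A B : AddSubgroup R}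

theorem lie_mem (hA : IsLieIdeal A) {x : R} (hx : x ∈ A) (r : R) : ⁅x, r⁆ ∈ A :=
  hA x hx r

theorem mul_mul_mem (hA : IsLieIdeal A) {x : R} (h : ∀ y, y * x ∈ A) (y v : R) :
    y * x * v ∈ A := by
  have hxv : y * x * v = ⁅y * x, v⁆ + v * y * x := by
    rw [Ring.lie_def]
    noncomm_ring
  rw [hxv]
  exact A.add_mem (hA.lie_mem (h y) v) (h (v * y))

theorem mul (hA : IsLieIdeal A) (hB : IsLieIdeal B) : IsLieIdeal (A * B) := by
  intro x hx r
  change ⁅x, r⁆ ∈ A * B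
  refine AddSubmonoid.mul_induction_on (C := fun x => ⁅x, r⁆ ∈ A * B) hx
    (fun a ha b hb => ?_) fun x y hx hy => ?_
  · rw [mul_lie_eq_add]
    exact add_mem (mul_mem_addSubgroup_mul ha (hB.lie_mem hb r))
      (mul_mem_addSubgroup_mul (hA.lie_mem ha r) hb)
  · convert add_mem hx hy using 1
    simp only [Ring.lie_def]
    noncomm_ring

theorem pow (hA : IsLieIdeal A) (n : ℕ+) : IsLieIdeal (addSubgroupPow A n) := by
  induction n using PNat.recOn with
  | one => exact hA
  | succ n ih => rw [addSubgroupPow_succ]; exact ih.mul hA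

theorem mul_lie_mul_lie_mem (hA : IsLieIdeal A) (hB : IsLieIdeal B) {a b : R} (ha : a ∈ A)
    (hb : b ∈ B) (y w : R) : y * (⁅a, b⁆ * ⁅b, w⁆) ∈ A * B := by
  have expand : y * (⁅a, b⁆ * ⁅b, w⁆) = ⁅a, y * b⁆ * ⁅b, w⁆ - ⁅a, y⁆ * ⁅b, b * w⁆ := by
    simp only [Ring.lie_def]
    noncomm_ring
  rw [expand]
  exact sub_mem (mul_mem_addSubgroup_mul (hA.lie_mem ha _) (hB.lie_mem hb _))
    (mul_mem_addSubgroup_mul (hA.lie_mem ha _) (hB.lie_mem hb _))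

variable [IsPrimeRing R]

theorem mul_ne_bot (hB : IsLieIdeal B) (hA0 : A ≠ ⊥) (hB0 : B ≠ ⊥) : A * B ≠ ⊥ := by
  intro hAB
  obtain ⟨a, ha, ha0⟩ := A.bot_or_exists_ne_zero.resolve_left hA0
  obtain ⟨b, hb, hb0⟩ := B.bot_or_exists_ne_zero.resolve_left hB0
  have mul_eq_zero : ∀ b ∈ B, a * b = 0 := fun b hb =>
    AddSubgroup.mem_bot.1 (hAB ▸ mul_mem_addSubgroup_mul ha hb)
  refine (IsPrimeRing.eq_zero_or_eq_zero a b fun r => ?_).elim ha0 hb0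
  calc a * r * b = a * b * r - a * ⁅b, r⁆ := by rw [Ring.lie_def]; noncomm_ring
    _ = 0 := by rw [mul_eq_zero b hb, mul_eq_zero _ (hB.lie_mem hb r), zero_mul, sub_zero]

theorem pow_ne_bot (hA : IsLieIdeal A) (hA0 : A ≠ ⊥) (n : ℕ+) : addSubgroupPow A n ≠ ⊥ := by
  induction n using PNat.recOn with
  | one => exact hA0
  | succ n ih => rw [addSubgroupPow_succ]; exact hA.mul_ne_bot ih hA0

end IsLieIdeal

namespace ContainsNonzeroIdeal

variable {R : Type*} [NonUnitalRing R] [IsPrimeRing R] {A B : AddSubgroup R}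

open Set in
theorem of_forall_mul_mul_mem {t : R} (ht : t ≠ 0) (h : ∀ y v, y * t * v ∈ A) :
    ContainsNonzeroIdeal A := by
  -- The outer factors of `t * r * t * s * t` put the generator itself, and not only its
  -- multiples, in `A`.
  obtain ⟨r, hr⟩ := IsPrimeRing.exists_mul_mul_ne ht ht
  obtain ⟨s, hx⟩ := IsPrimeRing.exists_mul_mul_ne hr ht
  set x := t * r * t * s * t with x_def
  have generators_mem : {x} ∪ {x} * univ ∪ univ * {x} ∪ univ * {x} * univ ⊆ (A : Set R) := by
    rintro _ (((rfl | ⟨_, rfl, v, -, rfl⟩) | ⟨y, -, _, rfl, rfl⟩) |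
      ⟨_, ⟨y, -, _, rfl, rfl⟩, v, -, rfl⟩)
    · simpa only [x_def, mul_assoc, SetLike.mem_coe] using h (t * r) (s * t)
    · simpa only [x_def, mul_assoc, SetLike.mem_coe] using h (t * r) (s * t * v)
    · simpa only [x_def, mul_assoc, SetLike.mem_coe] using h (y * t * r) (s * t)
    · simpa only [x_def, mul_assoc, SetLike.mem_coe] using h (y * t * r) (s * t * v)
  refine ⟨TwoSidedIdeal.span {x},
    IsPrimeRing.ne_bot_of_mem (TwoSidedIdeal.subset_span rfl) hx, fun z hz => ?_⟩
  exact (AddSubgroup.closure_le A).2 generators_mem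
    (TwoSidedIdeal.mem_span_iff_mem_addSubgroup_closure_nonunital.1 hz)

theorem commute (hA : ContainsNonzeroIdeal A) (h : ∀ x ∈ A, ∀ y ∈ A, Commute x y) (r s : R) :
    Commute r s := by
  obtain ⟨I, hI, hIA⟩ := hA
  exact IsPrimeRing.commute_of_commute_on_ideal hI
    (fun x hx y hy => h x (hIA x hx) y (hIA y hy)) r s

theorem mul_left (hB : ContainsNonzeroIdeal B) (hA : IsLieIdeal A) (hA0 : A ≠ ⊥) :
    ContainsNonzeroIdeal (A * B) := by
  obtain ⟨J, hJ, hJB⟩ := hB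
  obtain ⟨a, ha, ha0⟩ := A.bot_or_exists_ne_zero.resolve_left hA0
  obtain ⟨j, hj, haj⟩ : ∃ j ∈ J, a * j ≠ 0 := by
    by_contra! h
    exact ha0 (IsPrimeRing.eq_zero_of_mul_ideal hJ h)
  refine .of_forall_mul_mul_mem haj fun y v => ?_
  have hjv : j * v ∈ J := J.mul_mem_right _ _ hj
  have expand : y * (a * j) * v = a * (y * (j * v)) - ⁅a, y⁆ * (j * v) := by
    rw [Ring.lie_def]
    noncomm_ring
  rw [expand]
  exact sub_mem (mul_mem_addSubgroup_mul ha (hJB _ (J.mul_mem_left _ _ hjv)))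
    (mul_mem_addSubgroup_mul (hA.lie_mem ha y) (hJB _ hjv))

theorem mul_right (hA : ContainsNonzeroIdeal A) (hB : IsLieIdeal B) (hB0 : B ≠ ⊥) :
    ContainsNonzeroIdeal (A * B) := by
  obtain ⟨J, hJ, hJA⟩ := hA
  obtain ⟨b, hb, hb0⟩ := B.bot_or_exists_ne_zero.resolve_left hB0
  obtain ⟨j, hj, hjb⟩ : ∃ j ∈ J, j * b ≠ 0 := by
    by_contra! h
    exact hb0 (IsPrimeRing.eq_zero_of_ideal_mul hJ h)
  refine .of_forall_mul_mul_mem hjb fun y v => ?_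
  have hyj : y * j ∈ J := J.mul_mem_left _ _ hj
  have expand : y * (j * b) * v = y * j * v * b + y * j * ⁅b, v⁆ := by
    rw [Ring.lie_def]
    noncomm_ring
  rw [expand]
  exact add_mem (mul_mem_addSubgroup_mul (hJA _ (J.mul_mem_right _ _ hyj)) hb)
    (mul_mem_addSubgroup_mul (hJA _ hyj) (hB.lie_mem hb v))

theorem pow_mul_pow (h : ContainsNonzeroIdeal (A * B)) (hA : IsLieIdeal A) (hB : IsLieIdeal B)
    (hA0 : A ≠ ⊥) (hB0 : B ≠ ⊥) (m n : ℕ+) :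
    ContainsNonzeroIdeal (addSubgroupPow A m * addSubgroupPow B n) := by
  induction n using PNat.recOn with
  | one =>
    rw [addSubgroupPow_one]
    induction m using PNat.recOn with
    | one => exact h
    | succ m _ =>
      rw [addSubgroupPow_succ, addSubgroup_mul_assoc]
      exact h.mul_left (hA.pow m) (hA.pow_ne_bot hA0 m)
  | succ n ih =>
    rw [addSubgroupPow_succ, ← addSubgroup_mul_assoc]
    exact ih.mul_right hB hB0

theorem mul_of_lie_ne_zero (hA : IsLieIdeal A) (hB : IsLieIdeal B) {a b : R} (ha : a ∈ A)
    (hb : b ∈ B) (hab : ⁅a, b⁆ ≠ 0) : ContainsNonzeroIdeal (A * B) := by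
  obtain ⟨w, hw⟩ := exists_lie_mul_lie_ne_zero hab
  exact .of_forall_mul_mul_mem hw <|
    (hA.mul hB).mul_mul_mem fun y => hA.mul_lie_mul_lie_mem hB ha hb y w

end ContainsNonzeroIdeal

namespace SymmetricQuotientRing

variable {R : Type*} [NonUnitalRing R] [IsPrimeRing R]

theorem of_injective : Function.Injective (of R) := by
  intro r s h
  obtain ⟨J, hJ, _, _, hrs⟩ := mk_eq_mk.1 h
  refine sub_eq_zero.1 (IsPrimeRing.eq_zero_of_mul_ideal hJ fun x hx => ?_)
  rw [sub_mul, sub_eq_zero]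
  exact (hrs x hx).1

theorem of_eq_zero_iff {r : R} : of R r = 0 ↔ r = 0 :=
  map_eq_zero_iff _ of_injective

theorem of_lie (a r : R) : of R ⁅a, r⁆ = of R a * of R r - of R r * of R a := by
  rw [Ring.lie_def, map_sub, map_mul, map_mul]

theorem mk_mul_of (p : MartindaleTriple R) {x : R} (hx : x ∈ p.I) :
    mk p * of R x = of R (p.f x) := by
  refine mk_eq_of_forall fun y hy _ => ⟨p.f_mul x hx y, ?_⟩
  obtain ⟨⟨_, hy'⟩, _⟩ := MartindaleTriple.mem_pre.1 hy.2
  exact (p.balanced y hy' x hx).symm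

theorem exists_ideal_mul_of_eq_of (q : SymmetricQuotientRing R) :
    ∃ I : TwoSidedIdeal R, I ≠ ⊥ ∧ ∀ x ∈ I, ∃ y, q * of R x = of R y := by
  induction q using ind with
  | h p => exact ⟨p.I, p.ne_bot, fun x hx => ⟨_, mk_mul_of p hx⟩⟩

theorem eq_zero_of_mul_ideal {q : SymmetricQuotientRing R} {I : TwoSidedIdeal R} (hI : I ≠ ⊥)
    (h : ∀ x ∈ I, q * of R x = 0) : q = 0 := by
  induction q using ind with
  | h p =>
    have f_eq_zero : ∀ x ∈ I, x ∈ p.I → p.f x = 0 := fun x hx hxp => by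
      rw [← of_eq_zero_iff, ← mk_mul_of p hxp, h x hx]
    have g_eq_zero : ∀ x ∈ p.I, p.g x = 0 := fun x hxp =>
      IsPrimeRing.eq_zero_of_mul_ideal (IsPrimeRing.inf_ne_bot hI p.ne_bot) fun y hy => by
        rw [← p.balanced x hxp y hy.2, f_eq_zero y hy.1 hy.2, mul_zero]
    refine mk_eq_mk.2 (MartindaleTriple.rel_of_agree I hI fun x hx hxp _ => ⟨?_, ?_⟩)
    · exact (f_eq_zero x hx hxp).trans (zero_mul x).symm
    · exact (g_eq_zero x hxp).trans (mul_zero x).symm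

theorem exists_mul_of_eq_of_ne_zero {q : SymmetricQuotientRing R} (hq : q ≠ 0) :
    ∃ x y, q * of R x = of R y ∧ y ≠ 0 := by
  obtain ⟨I, hI, hqI⟩ := exists_ideal_mul_of_eq_of q
  by_contra! h
  refine hq (eq_zero_of_mul_ideal hI fun x hx => ?_)
  obtain ⟨y, hy⟩ := hqI x hx
  rw [hy, h x y hy, map_zero]

theorem eq_zero_or_eq_zero_of_mul_of_mul {p q : SymmetricQuotientRing R}
    (h : ∀ t, p * of R t * q = 0) : p = 0 ∨ q = 0 := by
  by_contra! hpq
  obtain ⟨x, y, hpx, hy⟩ := exists_mul_of_eq_of_ne_zero hpq.1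
  obtain ⟨z, w, hqz, hw⟩ := exists_mul_of_eq_of_ne_zero hpq.2
  refine (IsPrimeRing.eq_zero_or_eq_zero y w fun t => of_eq_zero_iff.1 ?_).elim hy hw
  calc of R (y * t * w) = p * of R (x * t) * q * of R z := by
        rw [map_mul, map_mul, ← hpx, ← hqz, map_mul]
        noncomm_ring
    _ = 0 := by rw [h, zero_mul]

instance : CommRing (extendedCentroid R) :=
  inferInstanceAs (CommRing (Subring.center (SymmetricQuotientRing R)))

instance : Algebra (extendedCentroid R) (SymmetricQuotientRing R) :=
  inferInstanceAs (Algebra (Subring.center (SymmetricQuotientRing R)) (SymmetricQuotientRing R))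

theorem extendedCentroid_smul_def (c : extendedCentroid R) (q : SymmetricQuotientRing R) :
    c • q = c * q :=
  rfl

theorem eq_zero_or_eq_zero_of_smul_eq_zero {c : extendedCentroid R} {q : SymmetricQuotientRing R}
    (h : c • q = 0) : c = 0 ∨ q = 0 := by
  refine (eq_zero_or_eq_zero_of_mul_of_mul (p := (c : SymmetricQuotientRing R))
    fun t => ?_).imp_left Subtype.ext
  rw [mul_assoc, ← extendedCentroid_smul_def, ← mul_smul_comm, h, mul_zero]

theorem mem_extendedCentroid_of_commute_of {q : SymmetricQuotientRing R}
    (h : ∀ r, Commute (of R r) q) : q ∈ extendedCentroid R := by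
  refine Subring.mem_center_iff.2 fun g => ?_
  obtain ⟨I, hI, hgI⟩ := exists_ideal_mul_of_eq_of g
  refine sub_eq_zero.1 (eq_zero_of_mul_ideal hI fun x hx => ?_)
  obtain ⟨y, hy⟩ := hgI x hx
  rw [sub_mul, sub_eq_zero]
  calc g * q * of R x = g * of R x * q := by rw [mul_assoc, ← (h x).eq, mul_assoc]
    _ = q * (g * of R x) := by rw [hy, (h y).eq]
    _ = q * g * of R x := (mul_assoc _ _ _).symm

theorem exists_smul_of_eq_of_bimodule_hom {I : TwoSidedIdeal R} (hI : I ≠ ⊥) (φ : R → R)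
    (map_add : ∀ x ∈ I, ∀ y ∈ I, φ (x + y) = φ x + φ y)
    (map_mul_right : ∀ x ∈ I, ∀ r, φ (x * r) = φ x * r)
    (map_mul_left : ∀ x ∈ I, ∀ r, φ (r * x) = r * φ x) :
    ∃ c : extendedCentroid R, ∀ x ∈ I, c • of R x = of R (φ x) := by
  let p : MartindaleTriple R :=
    { I := I
      f := φ
      g := φ
      ne_bot := hI
      f_add := map_add
      f_mul := map_mul_right
      g_add := map_add
      g_mul := map_mul_left
      balanced := fun x hx y hy => by rw [← map_mul_left y hy, map_mul_right x hx] }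
  have mk_mem : mk p ∈ extendedCentroid R := mem_extendedCentroid_of_commute_of fun r =>
    mk_eq_mk.2 <| MartindaleTriple.rel_of_agree I hI fun x hx _ _ =>
      ⟨(map_mul_left x hx r).symm, map_mul_right x hx r⟩
  exact ⟨⟨mk p, mk_mem⟩, fun x hx => mk_mul_of p hx⟩

/-- Martindale's lemma: `x ↦ y` whenever `x * t * v = y * t * u` for all `t` is a well-defined
bimodule homomorphism on an ideal containing `p`, and it takes `p` to `q`. -/
theorem exists_smul_of_forall_mul_mul_eq {p q u v : R} (hu : u ≠ 0)
    (h : ∀ t, p * t * v = q * t * u) :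
    ∃ c : extendedCentroid R, c • of R p = of R q := by
  have unique {x y z : R} (hy : ∀ t, x * t * v = y * t * u) (hz : ∀ t, x * t * v = z * t * u) :
      y = z :=
    sub_eq_zero.1 <| (IsPrimeRing.eq_zero_or_eq_zero _ u fun t => by
      rw [sub_mul, sub_mul, ← hy, ← hz, sub_self]).resolve_right hu
  rcases eq_or_ne p 0 with rfl | hp
  · exact ⟨0, by rw [unique (z := 0) h fun t => by simp only [zero_mul], map_zero, smul_zero]⟩
  have add {x y x' y' : R} (hx : ∀ t, x * t * v = y * t * u) (hx' : ∀ t, x' * t * v = y' * t * u)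
      (t : R) : (x + x') * t * v = (y + y') * t * u := by
    simp only [add_mul, hx, hx']
  have mul_left {x y : R} (r : R) (hx : ∀ t, x * t * v = y * t * u) (t : R) :
      r * x * t * v = r * y * t * u := by
    simpa only [mul_assoc] using congrArg (r * ·) (hx t)
  have mul_right {x y : R} (r : R) (hx : ∀ t, x * t * v = y * t * u) (t : R) :
      x * r * t * v = y * r * t * u := by
    simpa only [mul_assoc] using hx (r * t)
  let I : TwoSidedIdeal R := TwoSidedIdeal.mk' {x | ∃ y, ∀ t, x * t * v = y * t * u}
    ⟨0, fun t => by simp only [zero_mul]⟩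
    (fun ⟨y, hy⟩ ⟨y', hy'⟩ => ⟨y + y', add hy hy'⟩)
    (fun ⟨y, hy⟩ => ⟨-y, fun t => by simp only [neg_mul, hy]⟩)
    (fun {r _} ⟨y, hy⟩ => ⟨r * y, mul_left r hy⟩)
    (fun {_ r} ⟨y, hy⟩ => ⟨y * r, mul_right r hy⟩)
  have mem_I {x : R} : x ∈ I ↔ ∃ y, ∀ t, x * t * v = y * t * u :=
    TwoSidedIdeal.mem_mk' _ _ _ _ _ _ _
  choose! φ hφ using fun x (hx : x ∈ I) => mem_I.1 hx
  have hpI : p ∈ I := mem_I.2 ⟨q, h⟩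
  obtain ⟨c, hc⟩ := exists_smul_of_eq_of_bimodule_hom (IsPrimeRing.ne_bot_of_mem hpI hp) φ
    (fun x hx y hy => unique (hφ _ (I.add_mem hx hy)) (add (hφ x hx) (hφ y hy)))
    (fun x hx r => unique (hφ _ (I.mul_mem_right _ _ hx)) (mul_right r (hφ x hx)))
    (fun x hx r => unique (hφ _ (I.mul_mem_left _ _ hx)) (mul_left r (hφ x hx)))
  exact ⟨c, by rw [hc p hpI, unique (hφ p hpI) h]⟩

theorem isField_extendedCentroid : IsField (extendedCentroid R) where
  exists_pair_ne := by
    obtain ⟨r, hr⟩ := exists_ne (0 : R)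
    refine ⟨0, 1, fun h => hr (of_eq_zero_iff.1 ?_)⟩
    rw [← one_smul (extendedCentroid R) (of R r), ← h, zero_smul]
  mul_comm := mul_comm
  mul_inv_cancel := by
    intro c hc
    obtain ⟨x, y, hxy, hy⟩ := exists_mul_of_eq_of_ne_zero (q := (c : SymmetricQuotientRing R))
      fun h => hc (Subtype.ext h)
    rw [← extendedCentroid_smul_def] at hxy
    obtain ⟨d, hd⟩ := exists_smul_of_forall_mul_mul_eq (p := y) (q := x) (v := x) hy
      fun t => of_injective <| by simp only [map_mul, ← hxy, smul_mul_assoc, mul_smul_comm]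
    have hx : of R x ≠ 0 := fun h => hy (of_eq_zero_iff.1 (by rw [← hxy, h, smul_zero]))
    refine ⟨d, sub_eq_zero.1 ((eq_zero_or_eq_zero_of_smul_eq_zero ?_).resolve_right hx)⟩
    rw [sub_smul, one_smul, mul_comm, mul_smul, hxy, hd, sub_self]

theorem centroidLine_eq_span (a : R) :
    centroidLine a = (Submodule.span (extendedCentroid R) {of R a, 1} :
      Set (SymmetricQuotientRing R)) := by
  ext q
  simp only [SetLike.mem_coe, Submodule.mem_span_pair, Subtype.exists, extendedCentroid_smul_def,
    mul_one, exists_prop, eq_comm (b := q)]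
  rfl

theorem mulExtendedCentroid_eq_span (A : AddSubgroup R) :
    (mulExtendedCentroid A : Set (SymmetricQuotientRing R)) =
      Submodule.span (extendedCentroid R) (of R '' A) := by
  refine Set.Subset.antisymm ?_ fun q hq => ?_
  · refine addSubgroup_mul_le (D := (Submodule.span _ _).toAddSubgroup).2 ?_
    rintro _ ⟨a, ha, rfl⟩ c hc
    exact Subring.mem_center_iff.1 hc (of R a) ▸
      Submodule.smul_mem _ (⟨c, hc⟩ : extendedCentroid R) (Submodule.subset_span ⟨a, ha, rfl⟩)
  · rw [SetLike.mem_coe, ← Submodule.mem_toAddSubmonoid, Submodule.span_eq_closure] at hq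
    refine (AddSubmonoid.closure_le (S := (mulExtendedCentroid A).toAddSubmonoid)).2 ?_ hq
    rintro _ ⟨c, -, _, ⟨a, ha, rfl⟩, rfl⟩
    change c • of R a ∈ mulExtendedCentroid A
    rw [extendedCentroid_smul_def, ← Subring.mem_center_iff.1 c.2 (of R a)]
    exact mul_mem_addSubgroup_mul ⟨a, ha, rfl⟩ c.2

end SymmetricQuotientRing

section ExceptionalLieIdeals

open SymmetricQuotientRing Submodule

variable {R : Type*} [NonUnitalRing R] [IsPrimeRing R]

local notation "C" => extendedCentroid R

theorem of_mem_span_pair_of_lie_lie_eq_zero {a b : R} (ha : a ∉ NonUnitalSubring.center R)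
    (h : ∀ r : R, ⁅a, ⁅b, r⁆⁆ = 0) : of R b ∈ span C {of R a, 1} := by
  obtain ⟨r, hr⟩ := exists_lie_ne_zero ha
  have mul_lie_eq (t s : R) : ⁅a, r⁆ * t * ⁅b, s⁆ = -⁅b, r⁆ * t * ⁅a, s⁆ := by
    rw [neg_mul, neg_mul]
    exact eq_neg_of_add_eq_zero_left (lie_mul_mul_lie_add_eq_zero h r t s)
  obtain ⟨c, hc⟩ := exists_smul_of_forall_mul_mul_eq hr fun t => mul_lie_eq t r
  have lie_eq_smul_lie (s : R) : of R ⁅b, s⁆ = c • of R ⁅a, s⁆ := by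
    refine sub_eq_zero.1 <| (eq_zero_or_eq_zero_of_mul_of_mul (p := of R ⁅a, r⁆)
      fun t => ?_).resolve_left (of_eq_zero_iff.not.2 hr)
    rw [mul_sub, mul_smul_comm, ← smul_mul_assoc, ← smul_mul_assoc, hc, sub_eq_zero]
    simpa only [map_mul] using congrArg (of R) (mul_lie_eq t s)
  have sub_mem_C : of R b - c • of R a ∈ C := mem_extendedCentroid_of_commute_of fun s => by
    have hs := lie_eq_smul_lie s
    rw [of_lie, of_lie, smul_sub, sub_eq_sub_iff_sub_eq_sub] at hs
    rw [commute_iff_eq, mul_sub, sub_mul, mul_smul_comm, smul_mul_assoc, hs]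
  exact mem_span_pair.2 ⟨c, ⟨_, sub_mem_C⟩, by simp [extendedCentroid_smul_def]⟩

theorem mul_self_eq_zero_of_lie_mem_span {a : R} (ha : a ∉ NonUnitalSubring.center R)
    (h : ∀ r : R, of R ⁅a, r⁆ ∈ span C {of R a}) : a * a = 0 := by
  simp only [mem_span_singleton] at h
  obtain ⟨r, hr⟩ := exists_lie_ne_zero ha
  obtain ⟨c, hc⟩ := h r
  obtain ⟨d, hd⟩ := h (r * a)
  have hc0 : c ≠ 0 := by
    rintro rfl
    exact hr (of_eq_zero_iff.1 (by rw [← hc, zero_smul]))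
  have sq_eq : c • of R (a * a) = d • of R a := by
    rw [hd, lie_mul_eq_add, Ring.lie_def a a, sub_self, mul_zero, add_zero, map_mul, map_mul, ← hc,
      smul_mul_assoc]
  have smul_eq_zero : d • c • of R a = 0 := by
    have lie_sq : of R ⁅a * a, r⁆ = d • of R a + d • of R a := by
      rw [mul_lie_eq_add, map_add, map_mul, map_mul, ← hc, mul_smul_comm, smul_mul_assoc,
        ← map_mul, sq_eq]
    have smul_lie_sq : c • of R ⁅a * a, r⁆ = d • of R ⁅a, r⁆ := by
      rw [of_lie, of_lie, smul_sub, smul_sub, ← smul_mul_assoc, ← mul_smul_comm, sq_eq,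
        smul_mul_assoc, mul_smul_comm]
    rw [lie_sq, ← hc, smul_add, smul_comm c d] at smul_lie_sq
    exact add_eq_left.1 smul_lie_sq
  have hd0 : d = 0 := by
    rw [hc] at smul_eq_zero
    exact (eq_zero_or_eq_zero_of_smul_eq_zero smul_eq_zero).resolve_right (of_eq_zero_iff.not.2 hr)
  rw [hd0, zero_smul] at sq_eq
  exact of_eq_zero_iff.1 ((eq_zero_or_eq_zero_of_smul_eq_zero sq_eq).resolve_left hc0)

theorem mem_center_of_lie_mem_span {a : R} (h : ∀ r : R, of R ⁅a, r⁆ ∈ span C {of R a}) :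
    a ∈ NonUnitalSubring.center R := by
  by_contra ha
  have sq_eq_zero := mul_self_eq_zero_of_lie_mem_span ha h
  have ha0 : a ≠ 0 := fun ha0 => ha (ha0 ▸ zero_mem _)
  refine (IsPrimeRing.eq_zero_or_eq_zero a a fun s => ?_).elim ha0 ha0
  obtain ⟨c, hc⟩ := mem_span_singleton.1 (h s)
  have mul_lie_eq_zero : a * ⁅a, s⁆ = 0 := of_eq_zero_iff.1 <| by
    rw [map_mul, ← hc, mul_smul_comm, ← map_mul, sq_eq_zero, map_zero, smul_zero]
  rwa [Ring.lie_def, mul_sub, ← mul_assoc, sq_eq_zero, zero_mul, zero_sub, neg_eq_zero,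
    ← mul_assoc] at mul_lie_eq_zero

theorem IsLieIdeal.span_eq_span_pair {A : AddSubgroup R} (hA : IsLieIdeal A) {a : R} (ha : a ∈ A)
    (hac : a ∉ NonUnitalSubring.center R) (h : ∀ x ∈ A, of R x ∈ span C {of R a, 1}) :
    span C (of R '' A) = span C {of R a, 1} := by
  have mem_span {x : R} (hx : x ∈ A) : of R x ∈ span C (of R '' A) := subset_span ⟨x, hx, rfl⟩
  refine le_antisymm (span_le.2 ?_) (span_le.2 ?_)
  · rintro _ ⟨x, hx, rfl⟩
    exact h x hx
  obtain ⟨r, hr⟩ := not_forall.1 (mt mem_center_of_lie_mem_span hac)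
  obtain ⟨c, d, hcd⟩ := mem_span_pair.1 (h _ (hA.lie_mem ha r))
  have hd : d ≠ 0 := by
    rintro rfl
    exact hr (mem_span_singleton.2 ⟨c, by rw [← hcd, zero_smul, add_zero]⟩)
  obtain ⟨e, hde⟩ := isField_extendedCentroid.mul_inv_cancel hd
  have one_mem : e • (of R ⁅a, r⁆ - c • of R a) ∈ span C (of R '' A) :=
    smul_mem _ _ (sub_mem (mem_span (hA.lie_mem ha r)) (smul_mem _ _ (mem_span ha)))
  rw [← hcd, add_sub_cancel_left, smul_smul, mul_comm, hde, one_smul] at one_mem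
  exact Set.pair_subset (mem_span ha) one_mem

theorem IsLieIdeal.span_eq_span_pair_of_commute {A B : AddSubgroup R} (hA : IsLieIdeal A)
    (hB : IsLieIdeal B) (hBc : ¬ IsCentral B) (hAB : ∀ x ∈ A, ∀ y ∈ B, Commute x y) {a : R}
    (ha : a ∈ A) (hac : a ∉ NonUnitalSubring.center R) :
    span C (of R '' A) = span C {of R a, 1} ∧ span C (of R '' B) = span C {of R a, 1} := by
  have mem_span_left {x y : R} (hx : x ∈ A) (hxc : x ∉ NonUnitalSubring.center R) (hy : y ∈ B) :
      of R y ∈ span C {of R x, 1} :=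
    of_mem_span_pair_of_lie_lie_eq_zero hxc fun r =>
      commute_iff_lie_eq.1 (hAB x hx _ (hB.lie_mem hy r))
  have mem_span_right {x y : R} (hx : x ∈ A) (hy : y ∈ B) (hyc : y ∉ NonUnitalSubring.center R) :
      of R x ∈ span C {of R y, 1} :=
    of_mem_span_pair_of_lie_lie_eq_zero hyc fun r =>
      commute_iff_lie_eq.1 (hAB _ (hA.lie_mem hx r) y hy).symm
  obtain ⟨b, hb, hbc⟩ : ∃ b ∈ B, b ∉ NonUnitalSubring.center R := by
    simpa only [IsCentral, not_forall, exists_prop] using hBc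
  have one_mem (x : R) : 1 ∈ span C {of R x, 1} := subset_span (Set.mem_insert_of_mem _ rfl)
  have span_pair_eq : span C {of R b, 1} = span C {of R a, 1} :=
    le_antisymm (span_le.2 (Set.pair_subset (mem_span_left ha hac hb) (one_mem a)))
      (span_le.2 (Set.pair_subset (mem_span_right ha hb hbc) (one_mem b)))
  refine ⟨hA.span_eq_span_pair ha hac fun x hx => ?_, ?_⟩
  · rw [← span_pair_eq]
    exact mem_span_right hx hb hbc
  · rw [← span_pair_eq]
    refine hB.span_eq_span_pair hb hbc fun y hy => ?_
    rw [span_pair_eq]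
    exact mem_span_left ha hac hy

theorem not_containsNonzeroIdeal_pow_mul_pow {A B : AddSubgroup R} {a : R}
    (ha : a ∉ NonUnitalSubring.center R) (hA : ∀ x ∈ A, of R x ∈ span C {of R a, 1})
    (hB : ∀ x ∈ B, of R x ∈ span C {of R a, 1}) (m n : ℕ+) :
    ¬ ContainsNonzeroIdeal (addSubgroupPow A m * addSubgroupPow B n) := by
  have span_le_adjoin : span C {of R a, 1} ≤ Subalgebra.toSubmodule (Algebra.adjoin C {of R a}) :=
    span_le.2 (Set.pair_subset (Algebra.self_mem_adjoin_singleton C (of R a))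
      (Subalgebra.one_mem _))
  let D : NonUnitalSubring R :=
    (Algebra.adjoin C {of R a}).toSubring.toNonUnitalSubring.comap (of R)
  have mul_le : addSubgroupPow A m * addSubgroupPow B n ≤ D.toAddSubgroup :=
    addSubgroup_mul_le.2 fun x hx y hy =>
      D.mul_mem (addSubgroupPow_le (D := D) (fun x hx => span_le_adjoin (hA x hx)) m hx)
        (addSubgroupPow_le (D := D) (fun y hy => span_le_adjoin (hB y hy)) n hy)
  have commute {x y : R} (hx : x ∈ D) (hy : y ∈ D) : Commute x y :=
    .of_map of_injective <| Algebra.commute_of_mem_adjoin_singleton_of_commute hy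
      (Algebra.commute_of_mem_adjoin_self hx).symm
  exact fun hI => ha <| NonUnitalSubring.mem_center_iff.2 fun r =>
    hI.commute (fun x hx y hy => commute (mul_le hx) (mul_le hy)) r a

end ExceptionalLieIdeals

theorem mainTheorem6 {R : Type*} [NonUnitalRing R] [IsPrimeRing R] (K L : AddSubgroup R)
    (hK : IsLieIdeal K) (hL : IsLieIdeal L) (hKc : ¬ IsCentral K) (hLc : ¬ IsCentral L)
    (m n : ℕ+) :
    ContainsNonzeroIdeal (addSubgroupPow K m * addSubgroupPow L n) ↔
      ¬ ∀ a ∈ K, a ∉ NonUnitalSubring.center R →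
        (mulExtendedCentroid K : Set (SymmetricQuotientRing R)) = centroidLine a ∧
        (mulExtendedCentroid L : Set (SymmetricQuotientRing R)) = centroidLine a := by
  obtain ⟨a, ha, hac⟩ : ∃ a ∈ K, a ∉ NonUnitalSubring.center R := by
    simpa only [IsCentral, not_forall, exists_prop] using hKc
  simp only [SymmetricQuotientRing.mulExtendedCentroid_eq_span,
    SymmetricQuotientRing.centroidLine_eq_span, SetLike.coe_set_eq]
  refine ⟨fun hI h => ?_, fun h => ?_⟩
  · obtain ⟨hKa, hLa⟩ := h a ha hac
    exact not_containsNonzeroIdeal_pow_mul_pow hac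
      (fun x hx => hKa ▸ Submodule.subset_span ⟨x, hx, rfl⟩)
      (fun x hx => hLa ▸ Submodule.subset_span ⟨x, hx, rfl⟩) m n hI
  · obtain ⟨x, hx, y, hy, hxy⟩ : ∃ x ∈ K, ∃ y ∈ L, ⁅x, y⁆ ≠ 0 := by
      by_contra! hKL
      exact h fun a ha hac => hK.span_eq_span_pair_of_commute hL hLc
        (fun x hx y hy => commute_iff_lie_eq.2 (hKL x hx y hy)) ha hac
    exact (ContainsNonzeroIdeal.mul_of_lie_ne_zero hK hL hx hy hxy).pow_mul_pow hK hL
      (ne_bot_of_not_isCentral hKc) (ne_bot_of_not_isCentral hLc) m n
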